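/- Let $N\ge 1$ and $k\ge 2$ be integers, let $G\subseteq GL_2(\mathbb{Z}/N\mathbb{Z})$ be a subgroup, let $\lambda_N$ denote reduction modulo $N$ of integral matrices, and put $G_0=G\cap SL_2(\mathbb{Z}/N\mathbb{Z})$ and $\Gamma=\Gamma_G=\{\gamma\in SL_2(\mathbb{Z}):\lambda_N(\gamma)\in G_0\}$. Let $s:G_0\backslash SL_2(\mathbb{Z}/N\mathbb{Z})\to SL_2(\mathbb{Z})$ be a section of $\pi(g)=G_0\,\lambda_N(g)$. Let $n$ be a nonzero integer with $n \bmod N\in\det(G)$, let $\delta_n\in G$ satisfy $\det\delta_n=n \bmod N$, and let $M_2(\mathbb{Z})_n$ be the set of integral $2\times2$ matrices of determinant $n$. Put $$\Delta_n=\{\alpha\in M_2(\mathbb{Z})_n:\lambda_N(\alpha)\in G\},\qquad \phi_n:M_2(\mathbb{Z})_n\to SL_2(\mathbb{Z}),\quad \phi_n(\alpha)=s\big(G_0\cdot n^{-1}\delta_n\lambda_N(\alpha)\big).$$ For $g\in GL_2(\mathbb{Q})$ write $\tilde g=\det(g)\,g^{-1}$, and for $\Delta\subseteq GL_2(\mathbb{Q})$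 put $\tilde\Delta=\{g:\tilde g\in\Delta\}$. If $\Gamma\Delta=\Delta=\Delta\Gamma$, the set $\Gamma\backslash\Delta$ is finite, and $\phi$ is a map $\tilde\Delta\,SL_2(\mathbb{Z})\to SL_2(\mathbb{Z})$, then $(\Delta,\phi)$ is called a Merel pair for $\Gamma$ if (1) $\Gamma\phi(\gamma g)=\Gamma\phi(\gamma)g$ for all $\gamma\in\tilde\Delta\,SL_2(\mathbb{Z})$ and $g\in SL_2(\mathbb{Z})$; (2) $\gamma\phi(\gamma)^{-1}\in\tilde\Delta$ for all $\gamma\in\tilde\Delta\,SL_2(\mathbb{Z})$; (3) the map $\Gamma\backslash\Delta\to\tilde\Delta\,SL_2(\mathbb{Z})/SL_2(\mathbb{Z})$, $\Gamma\delta\mapsto\tilde\delta\,SL_2(\mathbb{Z})$, is injective. Let $GL_2(\mathbb{Q})$ act on $\mathbb{C}_{k-2}[X,Y]$ (the homogeneous polynomials of degree $k-2$) by $(gP)(X,Y)=P|_g(X,Y)=P(dX-bY,-cX+aY)$ for $g=\begin{pmatrix}a&b\\c&d\end{pmatrix}$. Let $\mathbb{M}_2$ be the complex vector space generated by symbols $\{a,b\}$,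 $a,b\in\mathbb{P}^1(\mathbb{Q})$, with relations $\{a,b\}+\{b,c\}+\{c,a\}=0$. Let $\mathbb{M}_k=\mathbb{C}_{k-2}[X,Y]\otimes\mathbb{M}_2$ with $g(P\otimes\{a,b\})=gP\otimes\{ga,gb\}$, and let $\mathbb{M}_k(\Gamma)$ be the space of $\Gamma$-coinvariants of $\mathbb{M}_k$. For $g\in SL_2(\mathbb{Z})$ let $[P,g]\in\mathbb{M}_k(\Gamma)$ be the class of $g(P\otimes\{0,\infty\})$. For $\Delta$ with $\Gamma\Delta=\Delta=\Delta\Gamma$ and $\Gamma\backslash\Delta$ finite, $T_\Delta^\vee$ is the endomorphism of $\mathbb{M}_k(\Gamma)$ sending the class of $x$ to the class of $\sum_{\delta}\delta x$, where $\delta$ runs over representatives of $\Gamma\backslash\Delta$; put $T_n^\vee=T_{\Delta_n}^\vee$. An element $\sum_M u_M M\in\mathbb{C}[M_2(\mathbb{Z})_n]$ satisfies condition $(C_n)$ if for every $K\in M_2(\mathbb{Z})_n/SL_2(\mathbb{Z})$ one has $\sum_{M\in K}u_M([M\infty]-[M0])=[\infty]-[0]$ in $\mathbb{C}[\mathbb{P}^1(\mathbb{Q})]$.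 Then: (a) $\tilde\Delta_n\,SL_2(\mathbb{Z})=M_2(\mathbb{Z})_n$, so that $\phi_n$ is defined on $\tilde\Delta_n\,SL_2(\mathbb{Z})$, and $(\Delta_n,\phi_n)$ is a Merel pair for $\Gamma_G$. (b) If $n$ is squarefree, then $\Delta_n=\Gamma\alpha\Gamma$ for every $\alpha\in\Delta_n$, so that $T_n^\vee=T_{\Gamma\alpha\Gamma}^\vee$. (c) For every $\sum_M u_M M$ satisfying $(C_n)$, every $P\in\mathbb{C}_{k-2}[X,Y]$ and every $g\in SL_2(\mathbb{Z})$, $$T_n^\vee([P,g])=\sum_M u_M\,[P|_{\tilde M},\phi_n(gM)]\quad\text{in }\mathbb{M}_k(\Gamma_G).$$ -/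

import Mathlib

open scoped MatrixGroups Pointwise TensorProduct

noncomputable section

namespace MerelHecke

/-! ### Matrices -/

/-- The embedding of `SL₂(ℤ)` into `GL₂(ℚ)`. -/
abbrev slQ : SL(2, ℤ) →* GL (Fin 2) ℚ := Matrix.SpecialLinearGroup.mapGL ℚ

/-- `SL₂(ℤ)` as a subset of `GL₂(ℚ)`. -/
def SLset : Set (GL (Fin 2) ℚ) := Set.range slQ

/-- The image in `GL₂(ℚ)` of a subgroup `Γ` of `SL₂(ℤ)`. -/
abbrev groupQ (Γ : Subgroup SL(2, ℤ)) : Subgroup (GL (Fin 2) ℚ) := Γ.map slQ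

/-- `g̃ = det(g) g⁻¹`. -/
def tilde (g : GL (Fin 2) ℚ) : GL (Fin 2) ℚ := Matrix.GeneralLinearGroup.det g • g⁻¹

/-- `Δ̃ = {g ∈ GL₂(ℚ) | g̃ ∈ Δ}`. -/
def tildeSet (Δ : Set (GL (Fin 2) ℚ)) : Set (GL (Fin 2) ℚ) := {g | tilde g ∈ Δ}

/-- `M₂(ℤ)ₙ`, the integral matrices of determinant `n`. -/
abbrev M2Z (n : ℤ) : Type := {A : Matrix (Fin 2) (Fin 2) ℤ // A.det = n}

/-- The product `g M` of `g ∈ SL₂(ℤ)` and `M ∈ M₂(ℤ)ₙ`. -/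
def leftMul {n : ℤ} (g : SL(2, ℤ)) (M : M2Z n) : M2Z n :=
  ⟨(g : Matrix (Fin 2) (Fin 2) ℤ) * M.1, by rw [Matrix.det_mul, g.2, M.2, one_mul]⟩

/-- The embedding of `M₂(ℤ)ₙ` into `GL₂(ℚ)`, for `n ≠ 0`. -/
def toGLQ {n : ℤ} [NeZero n] (α : M2Z n) : GL (Fin 2) ℚ :=
  Matrix.GeneralLinearGroup.mkOfDetNeZero (α.1.map (Int.castRingHom ℚ)) (by
    have h := (Int.castRingHom ℚ).map_det α.1
    rw [RingHom.mapMatrix_apply] at h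
    rw [← h, α.2]
    simpa using NeZero.ne n)

/-- The reduction `λ_N` on integral matrices. -/
def reduction (N : ℕ) (α : Matrix (Fin 2) (Fin 2) ℤ) : Matrix (Fin 2) (Fin 2) (ZMod N) :=
  α.map (Int.castRingHom (ZMod N))

/-! ### The group `Γ_G` and the section `s` -/

/-- `G₀ = G ∩ SL₂(ℤ/Nℤ)`. -/
def G0 {N : ℕ} (G : Subgroup (GL (Fin 2) (ZMod N))) : Subgroup SL(2, ZMod N) :=
  G.comap Matrix.SpecialLinearGroup.toGL

/-- `Γ_G`, the preimage of `G₀` in `SL₂(ℤ)`. -/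
def GammaG {N : ℕ} (G : Subgroup (GL (Fin 2) (ZMod N))) : Subgroup SL(2, ℤ) :=
  (G0 G).comap (Matrix.SpecialLinearGroup.map (Int.castRingHom (ZMod N)))

/-- The set `G₀ \ SL₂(ℤ/Nℤ)` of cosets `G₀ x`. -/
abbrev G0Cosets {N : ℕ} (G : Subgroup (GL (Fin 2) (ZMod N))) : Type :=
  Quotient (QuotientGroup.rightRel (G0 G))

/-- The coset `G₀ x`. -/
def G0coset {N : ℕ} (G : Subgroup (GL (Fin 2) (ZMod N))) (x : SL(2, ZMod N)) : G0Cosets G :=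
  Quotient.mk _ x

/-- `π : SL₂(ℤ) → G₀ \ SL₂(ℤ/Nℤ)`, `π(g) = G₀ λ_N(g)`. -/
def projG0 {N : ℕ} (G : Subgroup (GL (Fin 2) (ZMod N))) (g : SL(2, ℤ)) : G0Cosets G :=
  G0coset G (Matrix.SpecialLinearGroup.map (Int.castRingHom (ZMod N)) g)

/-! ### The pair `(Δₙ, φₙ)` -/

/-- `Δₙ = {α ∈ M₂(ℤ) | det α = n, λ_N(α) ∈ G}`, as a subset of `GL₂(ℚ)`. -/
def DeltaN {N : ℕ} (G : Subgroup (GL (Fin 2) (ZMod N))) (n : ℤ) [NeZero n] :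
    Set (GL (Fin 2) ℚ) :=
  toGLQ '' {α : M2Z n | ∃ g ∈ G, (g : Matrix (Fin 2) (Fin 2) (ZMod N)) = reduction N α.1}

/-- The element `n⁻¹ δ λ_N(α)` of `SL₂(ℤ/Nℤ)`, where `det δ = n` and `det α = n`. -/
def twist {N : ℕ} {n : ℤ} (δ : GL (Fin 2) (ZMod N))
    (hδ : (δ : Matrix (Fin 2) (Fin 2) (ZMod N)).det = (n : ZMod N)) (α : M2Z n) :
    SL(2, ZMod N) :=
  ⟨(n : ZMod N)⁻¹ • ((δ : Matrix (Fin 2) (Fin 2) (ZMod N)) * reduction N α.1), by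
    have hα : (reduction N α.1).det = (n : ZMod N) := by
      have h := (Int.castRingHom (ZMod N)).map_det α.1
      rw [RingHom.mapMatrix_apply, α.2] at h
      exact h.symm
    have hu : IsUnit (n : ZMod N) := by
      rw [← hδ]
      exact (Matrix.isUnit_iff_isUnit_det _).1 δ.isUnit
    rw [Matrix.det_smul, Matrix.det_mul, hδ, hα, Fintype.card_fin]
    have h1 := ZMod.inv_mul_of_unit _ hu
    calc (n : ZMod N)⁻¹ ^ 2 * ((n : ZMod N) * (n : ZMod N))
        = ((n : ZMod N)⁻¹ * n) * ((n : ZMod N)⁻¹ * n) := by ring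
      _ = 1 := by rw [h1, one_mul]⟩

/-- `φₙ : M₂(ℤ)ₙ → SL₂(ℤ)`, `φₙ(α) = s(G₀ n⁻¹ δ λ_N(α))`. -/
def phiN {N : ℕ} (G : Subgroup (GL (Fin 2) (ZMod N))) {n : ℤ} (δ : GL (Fin 2) (ZMod N))
    (hδ : (δ : Matrix (Fin 2) (Fin 2) (ZMod N)).det = (n : ZMod N))
    (s : G0Cosets G → SL(2, ℤ)) (α : M2Z n) : SL(2, ℤ) :=
  s (G0coset G (twist δ hδ α))

/-- `φₙ` as a function on `GL₂(ℚ)`; outside the image of `M₂(ℤ)ₙ` its value is irrelevant. -/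
def phiQ {N : ℕ} (G : Subgroup (GL (Fin 2) (ZMod N))) {n : ℤ} [NeZero n]
    (δ : GL (Fin 2) (ZMod N))
    (hδ : (δ : Matrix (Fin 2) (Fin 2) (ZMod N)).det = (n : ZMod N))
    (s : G0Cosets G → SL(2, ℤ)) : GL (Fin 2) ℚ → SL(2, ℤ) :=
  Function.extend toGLQ (phiN G δ hδ s) 1

/-! ### Merel pairs -/

/-- The set `Γ \ Δ` of cosets `Γ δ`, `δ ∈ Δ`. -/
def cosetsOf (Γ : Subgroup SL(2, ℤ)) (Δ : Set (GL (Fin 2) ℚ)) :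
    Set (Quotient (QuotientGroup.rightRel (groupQ Γ))) :=
  Quotient.mk _ '' Δ

/-- `ΓΔ = Δ = ΔΓ` and `Γ \ Δ` is finite. -/
structure IsHeckeSet (Γ : Subgroup SL(2, ℤ)) (Δ : Set (GL (Fin 2) ℚ)) : Prop where
  mul_left : (groupQ Γ : Set (GL (Fin 2) ℚ)) * Δ = Δ
  mul_right : Δ * (groupQ Γ : Set (GL (Fin 2) ℚ)) = Δ
  finite : (cosetsOf Γ Δ).Finite

/-- `(Δ, φ)` is a Merel pair for `Γ`. Only the values of `φ` on `Δ̃ SL₂(ℤ)` matter. -/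
structure IsMerelPair (Γ : Subgroup SL(2, ℤ)) (Δ : Set (GL (Fin 2) ℚ))
    (φ : GL (Fin 2) ℚ → SL(2, ℤ)) : Prop where
  isHeckeSet : IsHeckeSet Γ Δ
  equivariant : ∀ γ ∈ tildeSet Δ * SLset, ∀ g : SL(2, ℤ),
    (Γ : Set SL(2, ℤ)) * {φ (γ * slQ g)} = (Γ : Set SL(2, ℤ)) * {φ γ * g}
  mem_tilde : ∀ γ ∈ tildeSet Δ * SLset, γ * (slQ (φ γ))⁻¹ ∈ tildeSet Δ
  injective : ∀ δ₁ ∈ Δ, ∀ δ₂ ∈ Δ, ({tilde δ₁} : Set _) * SLset = {tilde δ₂} * SLset →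
    (groupQ Γ : Set (GL (Fin 2) ℚ)) * {δ₁} = (groupQ Γ : Set (GL (Fin 2) ℚ)) * {δ₂}

/-! ### Modular symbols with complex coefficients -/

/-- `ℙ¹(ℚ) = ℚ ∪ {∞}`, on which `GL₂(ℚ)` acts by Möbius transformations. -/
abbrev P1Q : Type := OnePoint ℚ

/-- The point `0` of `ℙ¹(ℚ)`. -/
def P1Q.zero : P1Q := ((0 : ℚ) : OnePoint ℚ)

/-- The point `∞` of `ℙ¹(ℚ)`. -/
def P1Q.infty : P1Q := OnePoint.infty

/-- The relations `{a,b} + {b,c} + {c,a}`. -/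
def symbolRelations : Submodule ℂ (P1Q × P1Q →₀ ℂ) :=
  Submodule.span ℂ {x | ∃ a b c : P1Q,
    x = Finsupp.single (a, b) 1 + Finsupp.single (b, c) 1 + Finsupp.single (c, a) 1}

/-- `𝕄₂` with complex coefficients. -/
abbrev Symb2 : Type := (P1Q × P1Q →₀ ℂ) ⧸ symbolRelations

/-- The symbol `{a, b}`. -/
def symb (a b : P1Q) : Symb2 := Submodule.Quotient.mk (Finsupp.single (a, b) 1)

lemma symbolRelations_le (g : GL (Fin 2) ℚ) :
    symbolRelations ≤ symbolRelations.comap (Finsupp.lmapDomain ℂ ℂ (g • · : P1Q × P1Q → _)) := by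
  refine Submodule.span_le.2 ?_
  rintro _ ⟨a, b, c, rfl⟩
  refine Submodule.subset_span ⟨g • a, g • b, g • c, ?_⟩
  simp only [map_add, Finsupp.lmapDomain_apply, Finsupp.mapDomain_single, Prod.smul_mk]

/-- The action `g{a, b} = {ga, gb}` of `GL₂(ℚ)` on `𝕄₂`. -/
def symbRep : Representation ℂ (GL (Fin 2) ℚ) Symb2 where
  toFun g := symbolRelations.mapQ symbolRelations
    (Finsupp.lmapDomain ℂ ℂ (g • · : P1Q × P1Q → _)) (symbolRelations_le g)
  map_one' := by
    ext x
    simp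
  map_mul' g h := by
    ext x
    simp [mul_smul]

/-- `ℂ_w[X, Y]`, the homogeneous polynomials of degree `w` in `X = X 0`, `Y = X 1`. -/
abbrev HomPoly (w : ℕ) : Type := MvPolynomial.homogeneousSubmodule (Fin 2) ℂ w

/-- The `i`-th linear form in `A (X, Y)ᵀ`. -/
def linForm (A : Matrix (Fin 2) (Fin 2) ℚ) (i : Fin 2) : MvPolynomial (Fin 2) ℂ :=
  ∑ j, MvPolynomial.C (A i j : ℂ) * MvPolynomial.X j

/-- The substitution `P ↦ P(A (X, Y)ᵀ)`. -/
def substPoly (w : ℕ) (A : Matrix (Fin 2) (Fin 2) ℚ) : HomPoly w →ₗ[ℂ] HomPoly w :=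
  (MvPolynomial.aeval (linForm A)).toLinearMap.restrict (fun P hP => by
    have h1 : ∀ i, (linForm A i).IsHomogeneous 1 := fun i =>
      MvPolynomial.IsHomogeneous.sum _ _ _ fun j _ => by
        simpa using (MvPolynomial.isHomogeneous_C (Fin 2) (A i j : ℂ)).mul
          (MvPolynomial.isHomogeneous_X ℂ j)
    simpa using MvPolynomial.IsHomogeneous.aeval hP (linForm A) h1)

lemma substPoly_one (w : ℕ) : substPoly w 1 = LinearMap.id := by
  ext1 P
  apply Subtype.ext
  have h : linForm 1 = MvPolynomial.X := by
    funext i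
    simp [linForm, Matrix.one_apply, apply_ite]
  change MvPolynomial.aeval (linForm 1) (P : MvPolynomial (Fin 2) ℂ) = P
  rw [h]
  simp

lemma substPoly_mul (w : ℕ) (A B : Matrix (Fin 2) (Fin 2) ℚ) :
    substPoly w (A * B) = substPoly w B ∘ₗ substPoly w A := by
  ext1 P
  apply Subtype.ext
  change MvPolynomial.aeval (linForm (A * B)) (P : MvPolynomial (Fin 2) ℂ) =
    MvPolynomial.aeval (linForm B) (MvPolynomial.aeval (linForm A) (P : MvPolynomial (Fin 2) ℂ))
  have h : MvPolynomial.aeval (linForm (A * B)) =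
      (MvPolynomial.aeval (linForm B)).comp (MvPolynomial.aeval (linForm A)) := by
    apply MvPolynomial.algHom_ext
    intro i
    rw [AlgHom.comp_apply, MvPolynomial.aeval_X, MvPolynomial.aeval_X]
    simp only [linForm, Fin.sum_univ_two, Matrix.mul_apply, map_add, map_mul,
      MvPolynomial.aeval_X, MvPolynomial.aeval_C, MvPolynomial.algebraMap_eq, Rat.cast_add,
      Rat.cast_mul]
    ring
  rw [h, AlgHom.comp_apply]

/-- The action of `GL₂(ℚ)` on `ℂ_w[X, Y]`: for `g = (a, b; c, d)`,
`(gP)(X, Y) = P(dX - bY, -cX + aY)`. This is also what is denoted `P|_g`. -/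
def polyRep (w : ℕ) : Representation ℂ (GL (Fin 2) ℚ) (HomPoly w) where
  toFun g := substPoly w (Matrix.adjugate (g : Matrix (Fin 2) (Fin 2) ℚ))
  map_one' := by
    rw [Units.val_one, Matrix.adjugate_one, substPoly_one]
    rfl
  map_mul' g h := by
    rw [Units.val_mul, Matrix.adjugate_mul_distrib, substPoly_mul]
    rfl

/-- `𝕄_k = ℂ_{k-2}[X, Y] ⊗ 𝕄₂`. -/
def SymbK (k : ℕ) : Type := HomPoly (k - 2) ⊗[ℂ] Symb2

instance (k : ℕ) : AddCommGroup (SymbK k) :=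
  inferInstanceAs (AddCommGroup (HomPoly (k - 2) ⊗[ℂ] Symb2))

instance (k : ℕ) : Module ℂ (SymbK k) :=
  inferInstanceAs (Module ℂ (HomPoly (k - 2) ⊗[ℂ] Symb2))

/-- The element `P ⊗ {a, b}` of `𝕄_k`. -/
def SymbK.tmul {k : ℕ} (P : HomPoly (k - 2)) (a b : P1Q) : SymbK k := P ⊗ₜ[ℂ] symb a b

/-- The diagonal action of `GL₂(ℚ)` on `𝕄_k`: `g (P ⊗ {a, b}) = gP ⊗ {ga, gb}`. -/
def symbolRep (k : ℕ) : Representation ℂ (GL (Fin 2) ℚ) (SymbK k) :=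
  (polyRep (k - 2)).tprod symbRep

/-- The action of `Γ` on `𝕄_k`. -/
def groupRep (k : ℕ) (Γ : Subgroup SL(2, ℤ)) : Representation ℂ (groupQ Γ) (SymbK k) :=
  (symbolRep k).comp (groupQ Γ).subtype

/-- `𝕄_k(Γ)`, the `Γ`-coinvariants of `𝕄_k`. -/
abbrev ModSymb (k : ℕ) (Γ : Subgroup SL(2, ℤ)) : Type := (groupRep k Γ).Coinvariants

/-- The Manin symbol `[P, g]`, the class of `g (P ⊗ {0, ∞})`. -/
def manin (k : ℕ) (Γ : Subgroup SL(2, ℤ)) (P : HomPoly (k - 2)) (g : SL(2, ℤ)) : ModSymb k Γ :=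
  Representation.Coinvariants.mk (groupRep k Γ)
    (symbolRep k (slQ g) (SymbK.tmul P P1Q.zero P1Q.infty))

/-! ### Dual Hecke operators -/

/-- The map `𝕄_k → 𝕄_k(Γ)`, `x ↦ [δ x]`, for a representative `δ` of a coset `q ∈ Γ \ GL₂(ℚ)`. -/
def cosetMap (k : ℕ) (Γ : Subgroup SL(2, ℤ))
    (q : Quotient (QuotientGroup.rightRel (groupQ Γ))) :
    SymbK k →ₗ[ℂ] ModSymb k Γ :=
  Representation.Coinvariants.mk (groupRep k Γ) ∘ₗ symbolRep k q.out

/-- `[δ x]` depends only on the coset `Γ δ`. -/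
lemma cosetMap_mk (k : ℕ) (Γ : Subgroup SL(2, ℤ)) (δ : GL (Fin 2) ℚ)
    (x : SymbK k) :
    cosetMap k Γ (Quotient.mk _ δ) x =
      Representation.Coinvariants.mk (groupRep k Γ) (symbolRep k δ x) := by
  set q : Quotient (QuotientGroup.rightRel (groupQ Γ)) := Quotient.mk _ δ with hq
  have h : (QuotientGroup.rightRel (groupQ Γ)) q.out δ := Quotient.exact (by simp [hq])
  rw [QuotientGroup.rightRel_apply] at h
  have h2 : symbolRep k δ x =
      groupRep k Γ ⟨δ * q.out⁻¹, h⟩ (symbolRep k q.out x) := by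
    change _ = symbolRep k (δ * q.out⁻¹) (symbolRep k q.out x)
    rw [← Module.End.mul_apply, ← map_mul, inv_mul_cancel_right]
  rw [h2, Representation.Coinvariants.mk_self_apply]
  rfl

/-- Right translation of cosets `Γ δ ↦ Γ δ h`. -/
def cosetRight (Γ : Subgroup SL(2, ℤ)) (h : GL (Fin 2) ℚ) :
    Quotient (QuotientGroup.rightRel (groupQ Γ)) → Quotient (QuotientGroup.rightRel (groupQ Γ)) :=
  Quotient.map (· * h) (fun a b hab => by
    change (QuotientGroup.rightRel (groupQ Γ)) _ _
    have hab' : (QuotientGroup.rightRel (groupQ Γ)) a b := hab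
    rw [QuotientGroup.rightRel_apply] at hab' ⊢
    simpa [mul_assoc] using hab')

/-- `T_Δ^∨ : 𝕄_k(Γ) → 𝕄_k(Γ)`, `v ⊗ {a, b} ↦ ∑_{Γδ ∈ Γ\Δ} δv ⊗ {δa, δb}`. -/
def heckeDual (k : ℕ) {Γ : Subgroup SL(2, ℤ)} {Δ : Set (GL (Fin 2) ℚ)} (hΔ : IsHeckeSet Γ Δ) :
    ModSymb k Γ →ₗ[ℂ] ModSymb k Γ :=
  Representation.Coinvariants.lift (groupRep k Γ)
    (∑ q ∈ hΔ.finite.toFinset, cosetMap k Γ q) (by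
      rintro ⟨γ, hγ⟩
      ext1 x
      have key : ∀ h : GL (Fin 2) ℚ, ∀ q, cosetMap k Γ q (symbolRep k h x) =
          cosetMap k Γ (cosetRight Γ h q) x := by
        intro h q
        induction q using Quotient.inductionOn with
        | h δ =>
          change _ = cosetMap k Γ (Quotient.mk _ (δ * h)) x
          rw [cosetMap_mk, cosetMap_mk, map_mul]
          rfl
      have mem : ∀ h ∈ groupQ Γ, ∀ q ∈ cosetsOf Γ Δ, cosetRight Γ h q ∈ cosetsOf Γ Δ := by
        rintro h hh _ ⟨δ, hδ, rfl⟩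
        exact ⟨δ * h, hΔ.mul_right ▸ Set.mul_mem_mul hδ hh, rfl⟩
      have inv : ∀ h g : GL (Fin 2) ℚ, h * g = 1 → ∀ q,
          cosetRight Γ g (cosetRight Γ h q) = q := by
        intro h g hg q
        induction q using Quotient.inductionOn with
        | h δ =>
          change Quotient.mk _ (δ * h * g) = _
          rw [mul_assoc, hg, mul_one]
      change (∑ q ∈ hΔ.finite.toFinset, cosetMap k Γ q) (symbolRep k γ x) =
        (∑ q ∈ hΔ.finite.toFinset, cosetMap k Γ q) x
      rw [LinearMap.sum_apply, LinearMap.sum_apply]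
      refine Finset.sum_nbij' (cosetRight Γ γ) (cosetRight Γ γ⁻¹) ?_ ?_ ?_ ?_ ?_
      · intro q hq
        simpa using mem γ hγ q (by simpa using hq)
      · intro q hq
        simpa using mem γ⁻¹ (inv_mem hγ) q (by simpa using hq)
      · intro q _
        exact inv _ _ (mul_inv_cancel γ) q
      · intro q _
        exact inv _ _ (inv_mul_cancel γ) q
      · intro q _
        exact key γ q)

/-! ### The condition `(Cₙ)` -/

open Classical in
/-- `∑ u_M M` satisfies `(Cₙ)`: for every `K = A SL₂(ℤ)` in `M₂(ℤ)ₙ / SL₂(ℤ)`,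
`∑_{M ∈ K} u_M ([M∞] - [M0]) = [∞] - [0]` in `ℂ[ℙ¹(ℚ)]`. -/
def ConditionC (n : ℤ) [NeZero n] (u : M2Z n →₀ ℂ) : Prop :=
  ∀ A : M2Z n,
    ∑ M ∈ u.support with (∃ h : SL(2, ℤ), M.1 = A.1 * (h : Matrix (Fin 2) (Fin 2) ℤ)),
      u M • (Finsupp.single (toGLQ M • P1Q.infty) (1 : ℂ) -
        Finsupp.single (toGLQ M • P1Q.zero) 1) =
    Finsupp.single P1Q.infty (1 : ℂ) - Finsupp.single P1Q.zero 1

end MerelHecke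

end

open MerelHecke

noncomputable section

namespace MerelHecke

/-! ### Matrices -/

/-! Two facts carry parts (a) and (c). First, `φₙ(M) M̃ ∈ Δₙ` for every `M`
(`leftMul_phiN_adj_mem`): modulo `N` the matrix `n⁻¹ δ M M̃` is `δ`, and the section changes it only
by a left factor in `G₀`. Second, for `d ∈ Δₙ` and `h ∈ SL₂(ℤ)`, `h d ∈ Δₙ` exactly when `h ∈ Γ`
(`slQ_mul_mem_DeltaN_iff`). Hence `Γ φₙ(M)` is characterised by `φₙ(M) M̃ ∈ Δₙ`, which gives the
axioms of a Merel pair; finiteness of `Γ \ Δₙ` comes from reduced matrices.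

For the Hecke formula, `M ↦ Γ φₙ(gM) (gM)~` induces a bijection from `M₂(ℤ)ₙ / SL₂(ℤ)` to `Γ \ Δₙ`
(`exists_merelCoset_eq`, `merelCoset_eq_iff`). The symbol `[P|M̃, φₙ(gM)]` is the image of `g (P ⊗
{M0, M∞})` under that coset (`manin_polyRep_tilde`). Grouping the sum by cosets, condition `(Cₙ)`
turns each group into the image of `g (P ⊗ {0, ∞})`, a single term of the Hecke operator.

For squarefree `n`, any two elements of `Δₙ` have the form `x D y` and `x' D y'` with `D = diag(1,
n)`. Since `n` is invertible modulo `N`, every class in the image of `SL₂(ℤ)` modulo `N` has a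
representative that `D` conjugates into `SL₂(ℤ)` (`exists_diagOne_mul_eq`). This makes the right
factor linking the two elements trivial modulo `N`; the left factor is then in `Γ` by the second
fact. -/

/-- The product `M g` of `M ∈ M₂(ℤ)ₙ` and `g ∈ SL₂(ℤ)`. -/
def rightMul {n : ℤ} (M : M2Z n) (g : SL(2, ℤ)) : M2Z n :=
  ⟨M.1 * (g : Matrix (Fin 2) (Fin 2) ℤ), by rw [Matrix.det_mul, g.2, M.2, mul_one]⟩

/-- The adjugate of an element of `M₂(ℤ)ₙ`. -/
def adj {n : ℤ} (M : M2Z n) : M2Z n :=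
  ⟨M.1.adjugate, by rw [Matrix.det_adjugate, M.2]; simp⟩

lemma slQ_injective : Function.Injective slQ := Matrix.SpecialLinearGroup.mapGL_injective

lemma slQ_mem_groupQ {Γ : Subgroup SL(2, ℤ)} {h : SL(2, ℤ)} : slQ h ∈ groupQ Γ ↔ h ∈ Γ :=
  Subgroup.mem_map_iff_mem slQ_injective

lemma coe_tilde (g : GL (Fin 2) ℚ) :
    (tilde g : Matrix (Fin 2) (Fin 2) ℚ) = (g : Matrix (Fin 2) (Fin 2) ℚ).adjugate := by
  have h : (g : Matrix (Fin 2) (Fin 2) ℚ).det ≠ 0 := g.det_ne_zero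
  rw [tilde, Units.val_smul, Matrix.coe_units_inv, Matrix.inv_def, Ring.inverse_eq_inv',
    Units.smul_def, Matrix.GeneralLinearGroup.val_det_apply, smul_smul, mul_inv_cancel₀ h, one_smul]

lemma tilde_tilde (g : GL (Fin 2) ℚ) : tilde (tilde g) = g := by
  apply Units.ext
  rw [coe_tilde, coe_tilde, Matrix.adjugate_adjugate _ (by simp)]
  simp

lemma tilde_mul (g h : GL (Fin 2) ℚ) : tilde (g * h) = tilde h * tilde g := by
  apply Units.ext
  simp only [coe_tilde, Units.val_mul, Matrix.adjugate_mul_distrib]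

lemma tilde_slQ (h : SL(2, ℤ)) : tilde (slQ h) = slQ h⁻¹ := by
  rw [tilde, Matrix.SpecialLinearGroup.det_mapGL, one_smul, map_inv]

lemma toGLQ_leftMul {n : ℤ} [NeZero n] (h : SL(2, ℤ)) (M : M2Z n) :
    toGLQ (leftMul h M) = slQ h * toGLQ M := by
  apply Units.ext
  exact Matrix.map_mul

lemma toGLQ_rightMul {n : ℤ} [NeZero n] (M : M2Z n) (h : SL(2, ℤ)) :
    toGLQ (rightMul M h) = toGLQ M * slQ h := by
  apply Units.ext
  exact Matrix.map_mul

lemma toGLQ_adj {n : ℤ} [NeZero n] (M : M2Z n) : toGLQ (adj M) = tilde (toGLQ M) := by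
  apply Units.ext
  rw [coe_tilde]
  exact (Int.castRingHom ℚ).map_adjugate M.1

lemma toGLQ_injective {n : ℤ} [NeZero n] : Function.Injective (toGLQ : M2Z n → _) := by
  intro A B h
  apply Subtype.ext
  have h' : A.1.map (Int.castRingHom ℚ) = B.1.map (Int.castRingHom ℚ) := congrArg Units.val h
  exact Matrix.map_injective (Int.castRingHom ℚ).injective_int h'

/-- The product `g̃ g` is the scalar matrix `det g`, and scalars act trivially on `ℙ¹(ℚ)`. -/
lemma tilde_mul_self_smul (g : GL (Fin 2) ℚ) (x : P1Q) : tilde g • g • x = x := by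
  have h : tilde g * g = Matrix.GeneralLinearGroup.det g • (1 : GL (Fin 2) ℚ) := by
    apply Units.ext
    rw [tilde, Units.val_mul, Units.val_smul, Units.val_smul, smul_mul_assoc, ← Units.val_mul,
      inv_mul_cancel]
  have hd : (Matrix.GeneralLinearGroup.det g : ℚ) ≠ 0 := Units.ne_zero _
  rw [← mul_smul, h]
  generalize Matrix.GeneralLinearGroup.det g = d at hd
  induction x using OnePoint.rec with
  | infty => simp [OnePoint.smul_infty_eq_ite]
  | coe c => simp [OnePoint.smul_some_eq_ite, Units.smul_def]

/-! ### Reduction modulo `N` -/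

section Reduction

variable {N : ℕ} {n : ℤ}

/-- The reduction modulo `N` on `SL₂(ℤ)`, with values in `GL₂(ℤ/Nℤ)`. -/
def slRed (N : ℕ) : SL(2, ℤ) →* GL (Fin 2) (ZMod N) :=
  Matrix.SpecialLinearGroup.toGL.comp (Matrix.SpecialLinearGroup.map (Int.castRingHom (ZMod N)))

lemma mem_GammaG {G : Subgroup (GL (Fin 2) (ZMod N))} {h : SL(2, ℤ)} :
    h ∈ GammaG G ↔ slRed N h ∈ G := Iff.rfl

lemma det_reduction (M : M2Z n) : (reduction N M.1).det = (n : ZMod N) := by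
  have h := (Int.castRingHom (ZMod N)).map_det M.1
  rw [RingHom.mapMatrix_apply, M.2] at h
  exact h.symm

/-- The reduction modulo `N` on `M₂(ℤ)ₙ`, for `n` invertible modulo `N`, with values in
`GL₂(ℤ/Nℤ)`. -/
def redGL (hn : IsUnit (n : ZMod N)) (M : M2Z n) : GL (Fin 2) (ZMod N) :=
  Matrix.GeneralLinearGroup.mk'' (reduction N M.1) (by rwa [det_reduction])

lemma redGL_leftMul (hn : IsUnit (n : ZMod N)) (h : SL(2, ℤ)) (M : M2Z n) :
    redGL hn (leftMul h M) = slRed N h * redGL hn M := by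
  apply Units.ext
  exact Matrix.map_mul

lemma redGL_rightMul (hn : IsUnit (n : ZMod N)) (M : M2Z n) (h : SL(2, ℤ)) :
    redGL hn (rightMul M h) = redGL hn M * slRed N h := by
  apply Units.ext
  exact Matrix.map_mul

lemma isUnit_of_det_eq {δ : GL (Fin 2) (ZMod N)}
    (hδ : (δ : Matrix (Fin 2) (Fin 2) (ZMod N)).det = (n : ZMod N)) : IsUnit (n : ZMod N) := by
  rw [← hδ]
  exact (Matrix.isUnit_iff_isUnit_det _).1 δ.isUnit

lemma toGLQ_mem_DeltaN [NeZero n] (hn : IsUnit (n : ZMod N)) {G : Subgroup (GL (Fin 2) (ZMod N))}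
    {M : M2Z n} : toGLQ M ∈ DeltaN G n ↔ redGL hn M ∈ G := by
  rw [DeltaN, toGLQ_injective.mem_set_image]
  constructor
  · rintro ⟨g, hg, h⟩
    rwa [show redGL hn M = g from Units.ext h.symm]
  · exact fun h => ⟨_, h, rfl⟩

/-- The factor `n⁻¹` in the definition of `φₙ` cancels `M · adj M = n`. -/
lemma toGL_twist_mul_redGL_adj (hn : IsUnit (n : ZMod N)) (δ : GL (Fin 2) (ZMod N))
    (hδ : (δ : Matrix (Fin 2) (Fin 2) (ZMod N)).det = (n : ZMod N)) (M : M2Z n) :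
    Matrix.SpecialLinearGroup.toGL (twist δ hδ M) * redGL hn (adj M) = δ := by
  apply Units.ext
  change ((n : ZMod N)⁻¹ • ((δ : Matrix (Fin 2) (Fin 2) (ZMod N)) * reduction N M.1)) *
    reduction N M.1.adjugate = δ
  have h : reduction N M.1.adjugate = (reduction N M.1).adjugate :=
    (Int.castRingHom (ZMod N)).map_adjugate M.1
  rw [h, smul_mul_assoc, mul_assoc, Matrix.mul_adjugate, det_reduction, mul_smul_comm, mul_one,
    smul_smul, ZMod.inv_mul_of_unit _ hn, one_smul]

lemma projG0_eq_G0coset_iff {G : Subgroup (GL (Fin 2) (ZMod N))} {h : SL(2, ℤ)}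
    {x : SL(2, ZMod N)} :
    projG0 G h = G0coset G x ↔ slRed N h * (Matrix.SpecialLinearGroup.toGL x)⁻¹ ∈ G := by
  have h1 : projG0 G h = G0coset G x ↔ (QuotientGroup.rightRel (G0 G)) x
      (Matrix.SpecialLinearGroup.map (Int.castRingHom (ZMod N)) h) :=
    eq_comm.trans Quotient.eq
  rw [h1, QuotientGroup.rightRel_apply]
  change Matrix.SpecialLinearGroup.toGL _ ∈ G ↔ _
  rw [map_mul, map_inv]
  rfl

/-- Modulo `N`, `φₙ(M)` lies in `G₀ δ (adj M)⁻¹`, so multiplying by `adj M` leaves an element of `G₀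
δ ⊆ G`. -/
lemma leftMul_phiN_adj_mem [NeZero n] {G : Subgroup (GL (Fin 2) (ZMod N))}
    {δ : GL (Fin 2) (ZMod N)} (hδG : δ ∈ G)
    (hδ : (δ : Matrix (Fin 2) (Fin 2) (ZMod N)).det = (n : ZMod N))
    {s : G0Cosets G → SL(2, ℤ)} (hs : ∀ q, projG0 G (s q) = q) (M : M2Z n) :
    slQ (phiN G δ hδ s M) * tilde (toGLQ M) ∈ DeltaN G n := by
  have hn : IsUnit (n : ZMod N) := isUnit_of_det_eq hδ
  rw [← toGLQ_adj, ← toGLQ_leftMul, toGLQ_mem_DeltaN hn, redGL_leftMul]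
  have h := projG0_eq_G0coset_iff.1 (hs (G0coset G (twist δ hδ M)))
  rw [← inv_mul_eq_iff_eq_mul.2 (toGL_twist_mul_redGL_adj hn δ hδ M).symm, ← mul_assoc]
  exact mul_mem h hδG

end Reduction

lemma phiQ_toGLQ {N : ℕ} (G : Subgroup (GL (Fin 2) (ZMod N))) {n : ℤ} [NeZero n]
    (δ : GL (Fin 2) (ZMod N))
    (hδ : (δ : Matrix (Fin 2) (Fin 2) (ZMod N)).det = (n : ZMod N))
    (s : G0Cosets G → SL(2, ℤ)) (M : M2Z n) : phiQ G δ hδ s (toGLQ M) = phiN G δ hδ s M :=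
  toGLQ_injective.extend_apply _ _ _

/-! ### The Merel pair `(Δₙ, φₙ)` -/

section MerelPair

variable {N : ℕ} {n : ℤ} [NeZero n] {G : Subgroup (GL (Fin 2) (ZMod N))}

lemma exists_toGLQ_of_mem_DeltaN {d : GL (Fin 2) ℚ} (hd : d ∈ DeltaN G n) :
    ∃ M : M2Z n, toGLQ M = d := by
  obtain ⟨M, -, rfl⟩ := hd
  exact ⟨M, rfl⟩

/-- The reduction of `d` lies in the group `G` and can be cancelled. Consequently `Δₙ` meets each
orbit `SL₂(ℤ) d` in at most one coset of `Γ`. -/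
lemma slQ_mul_mem_DeltaN_iff (hn : IsUnit (n : ZMod N)) {d : GL (Fin 2) ℚ} (hd : d ∈ DeltaN G n)
    {h : SL(2, ℤ)} : slQ h * d ∈ DeltaN G n ↔ h ∈ GammaG G := by
  obtain ⟨M, rfl⟩ := exists_toGLQ_of_mem_DeltaN hd
  rw [toGLQ_mem_DeltaN hn] at hd
  rw [← toGLQ_leftMul, toGLQ_mem_DeltaN hn, redGL_leftMul, mem_GammaG,
    Subgroup.mul_mem_cancel_right _ hd]

lemma mul_slQ_mem_DeltaN (hn : IsUnit (n : ZMod N)) {d : GL (Fin 2) ℚ} (hd : d ∈ DeltaN G n)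
    {h : SL(2, ℤ)} (hh : h ∈ GammaG G) : d * slQ h ∈ DeltaN G n := by
  obtain ⟨M, rfl⟩ := exists_toGLQ_of_mem_DeltaN hd
  rw [toGLQ_mem_DeltaN hn] at hd
  rw [← toGLQ_rightMul, toGLQ_mem_DeltaN hn, redGL_rightMul]
  exact mul_mem hd hh

lemma mk_slQ_mul {Γ : Subgroup SL(2, ℤ)} {h : SL(2, ℤ)} (hh : h ∈ Γ) (d : GL (Fin 2) ℚ) :
    (Quotient.mk (QuotientGroup.rightRel (groupQ Γ)) (slQ h * d)) = Quotient.mk _ d := by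
  refine Quotient.sound ?_
  change (QuotientGroup.rightRel (groupQ Γ)) _ _
  rw [QuotientGroup.rightRel_apply, mul_inv_rev, mul_inv_cancel_left]
  exact inv_mem (slQ_mem_groupQ.2 hh)

lemma exists_slQ_mul_of_mk_eq {Γ : Subgroup SL(2, ℤ)} {d d' : GL (Fin 2) ℚ}
    (h : (Quotient.mk (QuotientGroup.rightRel (groupQ Γ)) d) = Quotient.mk _ d') :
    ∃ γ ∈ Γ, d' = slQ γ * d := by
  have h1 : (QuotientGroup.rightRel (groupQ Γ)) d d' := Quotient.exact h
  rw [QuotientGroup.rightRel_apply] at h1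
  obtain ⟨γ, hγ, e⟩ := h1
  exact ⟨γ, hγ, by rw [e, inv_mul_cancel_right]⟩

/-- Two elements of `Δₙ` in the same left `SL₂(ℤ)`-orbit have the same coset modulo `Γ`. -/
lemma mk_eq_mk_of_mem_DeltaN (hn : IsUnit (n : ZMod N)) {d : GL (Fin 2) ℚ} {h h' : SL(2, ℤ)}
    (hd : slQ h * d ∈ DeltaN G n) (hd' : slQ h' * d ∈ DeltaN G n) :
    (Quotient.mk (QuotientGroup.rightRel (groupQ (GammaG G))) (slQ h * d)) =
      Quotient.mk _ (slQ h' * d) := by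
  have e : slQ h * d = slQ (h * h'⁻¹) * (slQ h' * d) := by
    rw [map_mul, map_inv, mul_assoc, inv_mul_cancel_left]
  rw [e]
  exact mk_slQ_mul ((slQ_mul_mem_DeltaN_iff hn hd').1 (e ▸ hd)) _

/-- The reduced matrices of determinant `n`. -/
def reduced (n : ℤ) : Set (M2Z n) :=
  {A | A.1 1 0 = 0 ∧ 0 < A.1 0 0 ∧ 0 ≤ A.1 0 1 ∧ |A.1 0 1| < |A.1 1 1|}

lemma finite_reduced (n : ℤ) : (reduced n).Finite :=
  Set.toFinite (FixedDetMatrices.reps n)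

/-- Every element of `M₂(ℤ)ₙ` is the product of an element of `SL₂(ℤ)` and a reduced matrix. -/
lemma exists_eq_leftMul_reduced (M : M2Z n) :
    ∃ h : SL(2, ℤ), ∃ R ∈ reduced n, M = leftMul h R := by
  refine FixedDetMatrices.induction_on (m := n)
    (C := fun M => ∃ h : SL(2, ℤ), ∃ R ∈ reduced n, M = leftMul h R)
    (NeZero.ne n) ?_ ?_ ?_
  · intro A h1 h2 h3 h4
    refine ⟨1, A, ⟨h1, h2, h3, h4⟩, Subtype.ext ?_⟩
    simp [leftMul]
  · rintro _ ⟨h, R, hR, rfl⟩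
    refine ⟨ModularGroup.S * h, R, hR, Subtype.ext ?_⟩
    exact (Matrix.mul_assoc _ _ _).symm
  · rintro _ ⟨h, R, hR, rfl⟩
    refine ⟨ModularGroup.T * h, R, hR, Subtype.ext ?_⟩
    exact (Matrix.mul_assoc _ _ _).symm

/-- Finitely many reduced matrices `R` represent all orbits `SL₂(ℤ) R`, and each orbit contributes
at most one coset. -/
lemma finite_cosetsOf_DeltaN (hn : IsUnit (n : ZMod N)) :
    (cosetsOf (GammaG G) (DeltaN G n)).Finite := by
  refine Set.Finite.subset ((finite_reduced n).biUnion (t := fun R => {q | ∃ h : SL(2, ℤ),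
    slQ h * toGLQ R ∈ DeltaN G n ∧
      q = Quotient.mk _ (slQ h * toGLQ R)}) ?_) ?_
  · intro R _
    apply Set.Subsingleton.finite
    rintro _ ⟨h, hd, rfl⟩ _ ⟨h', hd', rfl⟩
    exact mk_eq_mk_of_mem_DeltaN hn hd hd'
  · rintro _ ⟨d, hd, rfl⟩
    obtain ⟨M, rfl⟩ := exists_toGLQ_of_mem_DeltaN hd
    obtain ⟨h, R, hR, rfl⟩ := exists_eq_leftMul_reduced M
    rw [toGLQ_leftMul] at hd ⊢
    exact Set.mem_biUnion hR ⟨h, hd, rfl⟩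

lemma isHeckeSet_DeltaN (hn : IsUnit (n : ZMod N)) : IsHeckeSet (GammaG G) (DeltaN G n) where
  mul_left := by
    refine Set.Subset.antisymm ?_ (Set.subset_mul_right _ (one_mem (groupQ (GammaG G))))
    rintro _ ⟨_, ⟨γ, hγ, rfl⟩, d, hd, rfl⟩
    exact (slQ_mul_mem_DeltaN_iff hn hd).2 hγ
  mul_right := by
    refine Set.Subset.antisymm ?_ (Set.subset_mul_left _ (one_mem (groupQ (GammaG G))))
    rintro _ ⟨d, hd, _, ⟨γ, hγ, rfl⟩, rfl⟩
    exact mul_slQ_mem_DeltaN hn hd hγ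
  finite := finite_cosetsOf_DeltaN hn

variable {δ : GL (Fin 2) (ZMod N)} {s : G0Cosets G → SL(2, ℤ)}

lemma toGLQ_mul_inv_mem_tildeSet (hδG : δ ∈ G)
    (hδ : (δ : Matrix (Fin 2) (Fin 2) (ZMod N)).det = (n : ZMod N))
    (hs : ∀ q, projG0 G (s q) = q) (M : M2Z n) :
    toGLQ M * (slQ (phiN G δ hδ s M))⁻¹ ∈ tildeSet (DeltaN G n) := by
  change tilde _ ∈ DeltaN G n
  rw [tilde_mul, ← map_inv, tilde_slQ, inv_inv]
  exact leftMul_phiN_adj_mem hδG hδ hs M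

lemma tildeSet_DeltaN_mul_SLset (hδG : δ ∈ G)
    (hδ : (δ : Matrix (Fin 2) (Fin 2) (ZMod N)).det = (n : ZMod N))
    (hs : ∀ q, projG0 G (s q) = q) :
    tildeSet (DeltaN G n) * SLset = Set.range (toGLQ : M2Z n → GL (Fin 2) ℚ) := by
  apply Set.Subset.antisymm
  · rintro _ ⟨t, ht, _, ⟨h, rfl⟩, rfl⟩
    obtain ⟨M, hM⟩ := exists_toGLQ_of_mem_DeltaN (show tilde t ∈ DeltaN G n from ht)
    exact ⟨rightMul (adj M) h, by rw [toGLQ_rightMul, toGLQ_adj, hM, tilde_tilde]⟩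
  · rintro _ ⟨M, rfl⟩
    exact ⟨_, toGLQ_mul_inv_mem_tildeSet hδG hδ hs M, _, ⟨phiN G δ hδ s M, rfl⟩,
      inv_mul_cancel_right _ _⟩

lemma isMerelPair_DeltaN (hδG : δ ∈ G)
    (hδ : (δ : Matrix (Fin 2) (Fin 2) (ZMod N)).det = (n : ZMod N))
    (hs : ∀ q, projG0 G (s q) = q) :
    IsMerelPair (GammaG G) (DeltaN G n) (phiQ G δ hδ s) where
  isHeckeSet := isHeckeSet_DeltaN (isUnit_of_det_eq hδ)
  equivariant := by
    intro γ hγ g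
    rw [tildeSet_DeltaN_mul_SLset hδG hδ hs] at hγ
    obtain ⟨M, rfl⟩ := hγ
    rw [← toGLQ_rightMul, phiQ_toGLQ, phiQ_toGLQ]
    have h1 := leftMul_phiN_adj_mem hδG hδ hs M
    have h2 := leftMul_phiN_adj_mem hδG hδ hs (rightMul M g)
    generalize phiN G δ hδ s M = a at h1 ⊢
    generalize phiN G δ hδ s (rightMul M g) = b at h2 ⊢
    -- As `(Mg)~ = g⁻¹ M̃`, both `a M̃` and `b g⁻¹ M̃` lie in `Δₙ`, and they differ by the left
    -- factor `b g⁻¹ a⁻¹`.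
    have h3 : b * (a * g)⁻¹ ∈ GammaG G := by
      rw [← slQ_mul_mem_DeltaN_iff (isUnit_of_det_eq hδ) h1]
      rw [toGLQ_rightMul, tilde_mul, tilde_slQ, ← mul_assoc, ← map_mul] at h2
      rw [← mul_assoc, ← map_mul]
      convert h2 using 3
      group
    ext x
    simp only [Set.mul_singleton, Set.image_mul_right, Set.mem_preimage, SetLike.mem_coe]
    rw [← Subgroup.mul_mem_cancel_right (GammaG G) h3 (y := x * b⁻¹)]
    group
  mem_tilde := by
    intro γ hγ
    rw [tildeSet_DeltaN_mul_SLset hδG hδ hs] at hγ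
    obtain ⟨M, rfl⟩ := hγ
    rw [phiQ_toGLQ]
    exact toGLQ_mul_inv_mem_tildeSet hδG hδ hs M
  injective := by
    intro d₁ h₁ d₂ h₂ e
    have h3 : tilde d₁ ∈ ({tilde d₂} : Set _) * SLset :=
      e ▸ ⟨_, rfl, 1, ⟨1, map_one _⟩, mul_one _⟩
    obtain ⟨_, rfl, _, ⟨h, rfl⟩, e'⟩ := h3
    have e2 : d₁ = slQ h⁻¹ * d₂ := by
      rw [← tilde_tilde d₁, ← e', tilde_mul, tilde_tilde, tilde_slQ]
    rw [e2] at h₁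
    have h4 := slQ_mem_groupQ.2 ((slQ_mul_mem_DeltaN_iff (isUnit_of_det_eq hδ) h₂).1 h₁)
    rw [e2]
    generalize slQ h⁻¹ = y at h4
    ext x
    simp only [Set.mul_singleton, Set.image_mul_right, Set.mem_preimage, SetLike.mem_coe]
    rw [← Subgroup.mul_mem_cancel_right _ h4 (y := x * (y * d₂)⁻¹)]
    group

/-! ### The action of `T_n^∨` on Manin symbols -/

lemma symb_add_symb_add_symb (a b c : P1Q) : symb a b + symb b c + symb c a = 0 :=
  (Submodule.Quotient.mk_eq_zero _).2 (Submodule.subset_span ⟨a, b, c, rfl⟩)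

lemma symb_self (a : P1Q) : symb a a = 0 := by
  have h := symb_add_symb_add_symb a a a
  have h' : (3 : ℂ) • symb a a = 0 := by
    rw [← h]
    module
  simpa using h'

/-- With a fixed base point `c`, the symbol depends only on `[b] - [a]`; this lets an identity in
`ℂ[ℙ¹(ℚ)]` such as `(Cₙ)` be carried over to modular symbols. -/
lemma symb_eq_sub (a b c : P1Q) : symb a b = symb c b - symb c a := by
  have h := symb_add_symb_add_symb c a b
  have h' := symb_add_symb_add_symb c b b
  rw [symb_self, add_zero] at h'
  rw [eq_neg_of_add_eq_zero_right h'] at h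
  rw [eq_sub_iff_add_eq, ← sub_eq_zero, ← h]
  abel

/-- The linear map `ℂ[ℙ¹(ℚ)] → 𝕄_k`, `[a] ↦ P ⊗ {∞, a}`. -/
def pointSymb {k : ℕ} (P : HomPoly (k - 2)) : (P1Q →₀ ℂ) →ₗ[ℂ] SymbK k :=
  (TensorProduct.mk ℂ (HomPoly (k - 2)) Symb2 P) ∘ₗ Finsupp.linearCombination ℂ (symb P1Q.infty)

lemma pointSymb_sub {k : ℕ} (P : HomPoly (k - 2)) (a b : P1Q) :
    pointSymb P (Finsupp.single b 1 - Finsupp.single a 1) = SymbK.tmul P a b := by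
  have h : Finsupp.linearCombination ℂ (symb P1Q.infty) (Finsupp.single b 1 - Finsupp.single a 1) =
      symb a b := by
    rw [map_sub, Finsupp.linearCombination_single, Finsupp.linearCombination_single, one_smul,
      one_smul, ← symb_eq_sub]
  change P ⊗ₜ[ℂ] _ = P ⊗ₜ[ℂ] _
  rw [h]

lemma symbolRep_tmul {k : ℕ} (g : GL (Fin 2) ℚ) (P : HomPoly (k - 2)) (a b : P1Q) :
    symbolRep k g (SymbK.tmul P a b) = SymbK.tmul (polyRep (k - 2) g P) (g • a) (g • b) := by
  have h : symbRep g (symb a b) = symb (g • a) (g • b) := by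
    change Submodule.mapQ _ _ _ (symbolRelations_le g) (Submodule.Quotient.mk _) = _
    rw [Submodule.mapQ_apply, Finsupp.lmapDomain_apply, Finsupp.mapDomain_single]
    rfl
  change _ ⊗ₜ[ℂ] symbRep g (symb a b) = _
  rw [h]
  rfl

/-- Since `M̃ M` is scalar, `M̃P ⊗ {0, ∞} = M̃ (P ⊗ {M0, M∞})`, and `M̃ = (gM)~ g`. The operator
applied then depends on `M` only through a coset, and the remaining dependence is in the endpoints,
where `(Cₙ)` applies. -/
lemma manin_polyRep_tilde (k : ℕ) (Γ : Subgroup SL(2, ℤ)) (P : HomPoly (k - 2)) (M : M2Z n)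
    (g h : SL(2, ℤ)) :
    manin k Γ (polyRep (k - 2) (tilde (toGLQ M)) P) h =
      cosetMap k Γ (Quotient.mk _ (slQ h * tilde (toGLQ (leftMul g M))))
        (symbolRep k (slQ g)
          (SymbK.tmul P (toGLQ M • P1Q.zero) (toGLQ M • P1Q.infty))) := by
  have e : slQ h * tilde (toGLQ (leftMul g M)) * slQ g = slQ h * tilde (toGLQ M) := by
    rw [toGLQ_leftMul, tilde_mul, tilde_slQ, map_inv, mul_assoc, inv_mul_cancel_right]
  rw [cosetMap_mk, ← Module.End.mul_apply, ← map_mul, e, map_mul, Module.End.mul_apply,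
    symbolRep_tmul (tilde (toGLQ M)), tilde_mul_self_smul, tilde_mul_self_smul]
  rfl

lemma heckeDual_manin (k : ℕ) {Γ : Subgroup SL(2, ℤ)} {Δ : Set (GL (Fin 2) ℚ)}
    (hΔ : IsHeckeSet Γ Δ) (P : HomPoly (k - 2)) (g : SL(2, ℤ)) :
    heckeDual k hΔ (manin k Γ P g) = ∑ q ∈ hΔ.finite.toFinset,
      cosetMap k Γ q (symbolRep k (slQ g) (SymbK.tmul P P1Q.zero P1Q.infty)) := by
  rw [← LinearMap.sum_apply]
  rfl

/-- The coset `Γ φₙ(gM) (gM)~`. -/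
def merelCoset (G : Subgroup (GL (Fin 2) (ZMod N))) (δ : GL (Fin 2) (ZMod N))
    (hδ : (δ : Matrix (Fin 2) (Fin 2) (ZMod N)).det = (n : ZMod N))
    (s : G0Cosets G → SL(2, ℤ)) (g : SL(2, ℤ)) (M : M2Z n) :
    Quotient (QuotientGroup.rightRel (groupQ (GammaG G))) :=
  Quotient.mk _ (slQ (phiN G δ hδ s (leftMul g M)) * tilde (toGLQ (leftMul g M)))

lemma merelCoset_mem (hδG : δ ∈ G)
    (hδ : (δ : Matrix (Fin 2) (Fin 2) (ZMod N)).det = (n : ZMod N))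
    (hs : ∀ q, projG0 G (s q) = q) (g : SL(2, ℤ)) (M : M2Z n) :
    merelCoset G δ hδ s g M ∈ cosetsOf (GammaG G) (DeltaN G n) :=
  ⟨_, leftMul_phiN_adj_mem hδG hδ hs _, rfl⟩

lemma exists_merelCoset_eq (hδG : δ ∈ G)
    (hδ : (δ : Matrix (Fin 2) (Fin 2) (ZMod N)).det = (n : ZMod N))
    (hs : ∀ q, projG0 G (s q) = q) (g : SL(2, ℤ)) :
    ∀ q ∈ cosetsOf (GammaG G) (DeltaN G n), ∃ A : M2Z n, merelCoset G δ hδ s g A = q := by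
  rintro _ ⟨d, hd, rfl⟩
  obtain ⟨B, rfl⟩ := exists_toGLQ_of_mem_DeltaN hd
  -- Chosen so that `(gA)~ = B`.
  refine ⟨leftMul g⁻¹ (adj B), ?_⟩
  have h := leftMul_phiN_adj_mem hδG hδ hs (leftMul g (leftMul g⁻¹ (adj B)))
  have e : tilde (toGLQ (leftMul g (leftMul g⁻¹ (adj B)))) = toGLQ B := by
    rw [toGLQ_leftMul, toGLQ_leftMul, map_inv, mul_inv_cancel_left, toGLQ_adj, tilde_tilde]
  rw [merelCoset, e]
  rw [e] at h
  exact mk_slQ_mul ((slQ_mul_mem_DeltaN_iff (isUnit_of_det_eq hδ) hd).1 h) _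

/-- Equal cosets put `(gM)~` and `(gA)~` in the same left `SL₂(ℤ)`-orbit, and the anti-involution
`~` turns left orbits into right orbits. Conversely, both representatives lie in `Δₙ`, which meets
that orbit in a single coset. -/
lemma merelCoset_eq_iff (hδG : δ ∈ G)
    (hδ : (δ : Matrix (Fin 2) (Fin 2) (ZMod N)).det = (n : ZMod N))
    (hs : ∀ q, projG0 G (s q) = q) (g : SL(2, ℤ)) (M A : M2Z n) :
    merelCoset G δ hδ s g M = merelCoset G δ hδ s g A ↔
      ∃ h : SL(2, ℤ), M.1 = A.1 * (h : Matrix (Fin 2) (Fin 2) ℤ) := by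
  have hA := leftMul_phiN_adj_mem hδG hδ hs (leftMul g A)
  have hM := leftMul_phiN_adj_mem hδG hδ hs (leftMul g M)
  constructor
  · intro e
    obtain ⟨γ, -, e'⟩ := exists_slQ_mul_of_mk_eq e.symm
    generalize phiN G δ hδ s (leftMul g M) = b at e'
    generalize phiN G δ hδ s (leftMul g A) = a at e'
    rw [toGLQ_leftMul, toGLQ_leftMul, tilde_mul, tilde_mul, ← mul_assoc, ← mul_assoc, ← mul_assoc,
      mul_left_inj] at e'
    refine ⟨(b⁻¹ * γ * a)⁻¹, congrArg Subtype.val (a₁ := M) (a₂ := rightMul A _) ?_⟩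
    apply toGLQ_injective
    rw [toGLQ_rightMul, ← tilde_tilde (toGLQ M), ← tilde_slQ, ← tilde_tilde (toGLQ A), ← tilde_mul,
      tilde_tilde, map_mul, map_mul, mul_assoc, mul_assoc, ← mul_assoc (slQ γ), ← e', map_inv,
      inv_mul_cancel_left, tilde_tilde]
  · rintro ⟨h, e⟩
    obtain rfl : M = rightMul A h := Subtype.ext e
    have e' : tilde (toGLQ (leftMul g (rightMul A h))) =
        slQ h⁻¹ * tilde (toGLQ (leftMul g A)) := by
      rw [toGLQ_leftMul, toGLQ_leftMul, toGLQ_rightMul, ← mul_assoc, tilde_mul, tilde_slQ]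
    rw [merelCoset, merelCoset]
    rw [e', ← mul_assoc, ← map_mul] at hM ⊢
    exact mk_eq_mk_of_mem_DeltaN (isUnit_of_det_eq hδ) hM hA

theorem heckeDual_manin_eq_sum (k : ℕ) (hδG : δ ∈ G)
    (hδ : (δ : Matrix (Fin 2) (Fin 2) (ZMod N)).det = (n : ZMod N))
    (hs : ∀ q, projG0 G (s q) = q) (hΔ : IsHeckeSet (GammaG G) (DeltaN G n)) (u : M2Z n →₀ ℂ)
    (hu : ConditionC n u) (P : HomPoly (k - 2)) (g : SL(2, ℤ)) :
    heckeDual k hΔ (manin k (GammaG G) P g) =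
      u.sum fun M c => c • manin k (GammaG G) (polyRep (k - 2) (tilde (toGLQ M)) P)
        (phiN G δ hδ s (leftMul g M)) := by
  classical
  rw [heckeDual_manin, Finsupp.sum, ← Finset.sum_fiberwise_of_maps_to
    (t := hΔ.finite.toFinset) (g := merelCoset G δ hδ s g)
    (fun M _ => hΔ.finite.mem_toFinset.2 (merelCoset_mem hδG hδ hs g M))]
  refine Finset.sum_congr rfl fun q hq => ?_
  obtain ⟨A, rfl⟩ := exists_merelCoset_eq hδG hδ hs g q (hΔ.finite.mem_toFinset.1 hq)
  -- Condition `(Cₙ)` for `A SL₂(ℤ)`, pushed through `[a] ↦ P ⊗ {∞, a}`, then `g`, then the coset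
  -- attached to `A`.
  have h := congrArg (cosetMap k (GammaG G) (merelCoset G δ hδ s g A) ∘ₗ symbolRep k (slQ g) ∘ₗ
    pointSymb P) (hu A)
  simp only [map_sum, map_smul, LinearMap.comp_apply, pointSymb_sub] at h
  rw [← h]
  refine Finset.sum_congr ?_ fun M hM => ?_
  · exact Finset.filter_congr fun M _ => (merelCoset_eq_iff hδG hδ hs g M A).symm
  · rw [manin_polyRep_tilde k (GammaG G) P M g, ← (Finset.mem_filter.1 hM).2]
    rfl

end MerelPair

/-! ### Squarefree determinants -/

section Squarefree

variable {n : ℤ}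

/-- The matrix `diag(1, n)`. -/
def diagOne (n : ℤ) : M2Z n := ⟨!![1, 0; 0, n], by simp [Matrix.det_fin_two]⟩

/-- For squarefree `n`, all elements of `M₂(ℤ)ₙ` have the Smith normal form `diag(1, n)`. -/
lemma exists_eq_leftMul_rightMul_diagOne [NeZero n] (hn : Squarefree n) (M : M2Z n) :
    ∃ x y : SL(2, ℤ), M = leftMul x (rightMul (diagOne n) y) := by
  obtain ⟨h, R, hR, rfl⟩ := exists_eq_leftMul_reduced M
  have h10 : R.1 1 0 = 0 := hR.1
  have hdet : R.1 0 0 * R.1 1 1 = n := by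
    have := R.2
    rwa [Matrix.det_fin_two, h10, mul_zero, sub_zero] at this
  obtain ⟨p, q, hpq⟩ : IsCoprime (R.1 0 0) (R.1 1 1) := by
    rw [← hdet, squarefree_mul_iff] at hn
    exact hn.1.isCoprime
  set a := R.1 0 0
  set b := R.1 0 1
  set d := R.1 1 1
  -- With `pa + qd = 1`, `R = (1, bq; 0, 1) diag(a, d) (1, bp; 0, 1)` and `diag(a, d) = (a, -q; d,
  -- p) diag(1, ad) (pa, qd; -1, 1)`. The matrices `x` and `y` are the products of the outer
  -- factors.
  let x : SL(2, ℤ) := ⟨!![a + b * q * d, -q + b * q * p; d, p], by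
    rw [Matrix.det_fin_two_of]
    linear_combination hpq⟩
  let y : SL(2, ℤ) := ⟨!![p * a, p * a * b * p + q * d; -1, 1 - b * p], by
    rw [Matrix.det_fin_two_of]
    linear_combination hpq⟩
  refine ⟨h * x, y, Subtype.ext ?_⟩
  have hR' : R.1 = !![a, b; 0, d] := by
    rw [Matrix.eta_fin_two R.1, h10]
  have key : R.1 = x.1 * ((diagOne n).1 * y.1) := by
    rw [hR']
    simp only [x, y, diagOne, Matrix.mul_fin_two, ← hdet]
    congr 1
    ext i j
    fin_cases i <;> fin_cases j
    · simp
      linear_combination (-a) * hpq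
    · simp
      linear_combination (-b * (p * a + q * d + 1)) * hpq
    · simp
      ring
    · simp
      linear_combination (-d) * hpq
  change (h : Matrix (Fin 2) (Fin 2) ℤ) * R.1 = (h * x : SL(2, ℤ)).1 * ((diagOne n).1 * y.1)
  rw [key, Matrix.SpecialLinearGroup.coe_mul, Matrix.mul_assoc]

lemma diagOne_mul_T_zpow [NeZero n] (m : ℤ) :
    toGLQ (diagOne n) * slQ (ModularGroup.T ^ (n * m)) =
      slQ (ModularGroup.T ^ m) * toGLQ (diagOne n) := by
  rw [← toGLQ_rightMul, ← toGLQ_leftMul]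
  congr 1
  apply Subtype.ext
  simp [rightMul, leftMul, diagOne, ModularGroup.coe_T_zpow, mul_comm]

/-- The matrix `(1, 0; m, 1)`. -/
def lowerUnipotent (m : ℤ) : SL(2, ℤ) := ⟨!![1, 0; m, 1], by simp [Matrix.det_fin_two]⟩

/-- Modulo `N`, every element of `SL₂(ℤ)` is congruent to an element of
`SL₂(ℤ) ∩ D⁻¹ SL₂(ℤ) D`, where `D = diag(1, n)` and `n` is invertible modulo `N`. -/
lemma exists_diagOne_mul_eq [NeZero n] {N : ℕ} (hn : IsUnit (n : ZMod N)) (y : SL(2, ℤ)) :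
    ∃ y₀ z : SL(2, ℤ), slRed N y₀ = slRed N y ∧
      toGLQ (diagOne n) * slQ y₀ = slQ z * toGLQ (diagOne n) := by
  -- The elements with the required property form a subgroup, so it suffices to treat the generators
  -- `S` and `T`.
  let K : Subgroup SL(2, ℤ) :=
    { carrier := {y | ∃ y₀ z : SL(2, ℤ), slRed N y₀ = slRed N y ∧
        toGLQ (diagOne n) * slQ y₀ = slQ z * toGLQ (diagOne n)}
      one_mem' := ⟨1, 1, rfl, by rw [map_one, one_mul, mul_one]⟩
      mul_mem' := by
        rintro _ _ ⟨y₁, z₁, h₁, e₁⟩ ⟨y₂, z₂, h₂, e₂⟩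
        refine ⟨y₁ * y₂, z₁ * z₂, by rw [map_mul, map_mul, h₁, h₂], ?_⟩
        rw [map_mul, map_mul, ← mul_assoc, e₁, mul_assoc, e₂, mul_assoc]
      inv_mem' := by
        rintro _ ⟨y₁, z₁, h₁, e₁⟩
        refine ⟨y₁⁻¹, z₁⁻¹, by rw [map_inv, map_inv, h₁], ?_⟩
        rw [map_inv, map_inv, eq_inv_mul_iff_mul_eq, ← mul_assoc, ← e₁, mul_inv_cancel_right] }
  have hT : ModularGroup.T ∈ K := by
    -- With `m` inverse to `n` modulo `N`, `T ^ (n * m)` is congruent to `T`, and conjugation by `D`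
    -- sends it to `T ^ m`.
    obtain ⟨m, hm⟩ := ZMod.intCast_surjective (n : ZMod N)⁻¹
    refine ⟨ModularGroup.T ^ (n * m), ModularGroup.T ^ m, ?_, diagOne_mul_T_zpow m⟩
    have h1 : ((n * m : ℤ) : ZMod N) = 1 := by
      rw [Int.cast_mul, hm, ZMod.mul_inv_of_unit _ hn]
    apply Units.ext
    change (ModularGroup.T ^ (n * m)).1.map (Int.castRingHom (ZMod N)) =
      ModularGroup.T.1.map (Int.castRingHom (ZMod N))
    rw [ModularGroup.coe_T_zpow, ModularGroup.coe_T]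
    ext i j
    fin_cases i <;> fin_cases j <;> simp
    simpa using h1
  have hL : lowerUnipotent 1 ∈ K := by
    refine ⟨lowerUnipotent 1, lowerUnipotent n, rfl, ?_⟩
    rw [← toGLQ_rightMul, ← toGLQ_leftMul]
    congr 1
    apply Subtype.ext
    simp [rightMul, leftMul, diagOne, lowerUnipotent]
  have hS : ModularGroup.S ∈ K := by
    have e : ModularGroup.S = ModularGroup.T⁻¹ * lowerUnipotent 1 * ModularGroup.T⁻¹ := by
      rw [eq_mul_inv_iff_mul_eq, eq_inv_mul_iff_mul_eq]
      apply Subtype.ext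
      rw [Matrix.SpecialLinearGroup.coe_mul, Matrix.SpecialLinearGroup.coe_mul, ModularGroup.coe_S,
        ModularGroup.coe_T]
      simp [lowerUnipotent]
    rw [e]
    exact mul_mem (mul_mem (inv_mem hT) hL) (inv_mem hT)
  have hK : K = ⊤ := by
    rw [eq_top_iff, ← SpecialLinearGroup.SL2Z_generators, Subgroup.closure_le]
    rintro _ (rfl | rfl)
    exacts [hS, hT]
  exact (hK ▸ Subgroup.mem_top y : y ∈ K)

theorem DeltaN_eq_doubleCoset [NeZero n] {N : ℕ} {G : Subgroup (GL (Fin 2) (ZMod N))}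
    (hn : IsUnit (n : ZMod N)) (hsq : Squarefree n) {α : GL (Fin 2) ℚ} (hα : α ∈ DeltaN G n) :
    (groupQ (GammaG G) : Set (GL (Fin 2) ℚ)) * {α} * (groupQ (GammaG G) : Set _) =
      DeltaN G n := by
  have hΔ := isHeckeSet_DeltaN (G := G) hn
  apply Set.Subset.antisymm
  · refine (Set.mul_subset_mul_right
      (Set.mul_subset_mul_left (Set.singleton_subset_iff.2 hα))).trans_eq ?_
    rw [hΔ.mul_left, hΔ.mul_right]
  · intro β hβ
    obtain ⟨A, rfl⟩ := exists_toGLQ_of_mem_DeltaN hα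
    obtain ⟨B, rfl⟩ := exists_toGLQ_of_mem_DeltaN hβ
    obtain ⟨x, y, rfl⟩ := exists_eq_leftMul_rightMul_diagOne hsq A
    obtain ⟨x', y', rfl⟩ := exists_eq_leftMul_rightMul_diagOne hsq B
    obtain ⟨y₀, z, h, e⟩ := exists_diagOne_mul_eq hn (y' * y⁻¹)
    rw [toGLQ_leftMul, toGLQ_rightMul] at hα hβ ⊢
    rw [toGLQ_leftMul, toGLQ_rightMul]
    generalize toGLQ (diagOne n) = D at *
    -- The reduction of this element is the identity, because `y₀` is congruent to `y' y⁻¹`.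
    have hw : y⁻¹ * y₀⁻¹ * y' ∈ GammaG G := by
      rw [mem_GammaG, map_mul, map_mul, map_inv, map_inv, h, map_mul, map_inv]
      convert one_mem G
      group
    have hαw := mul_slQ_mem_DeltaN hn hα hw
    have e2 : slQ x' * (D * slQ y') =
        slQ (x' * z * x⁻¹) * (slQ x * (D * slQ y) * slQ (y⁻¹ * y₀⁻¹ * y')) := by
      have e' : slQ z = D * slQ y₀ * D⁻¹ := by rw [e, mul_inv_cancel_right]
      simp only [map_mul, map_inv, e']
      group
    -- No congruence for `x' z x⁻¹` is computed: it carries one element of `Δₙ` to another, hence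
    -- lies in `Γ`.
    rw [e2] at hβ
    refine ⟨slQ (x' * z * x⁻¹) * (slQ x * (D * slQ y)), ⟨_, slQ_mem_groupQ.2
      ((slQ_mul_mem_DeltaN_iff hn hαw).1 hβ), _, rfl, rfl⟩, _, slQ_mem_groupQ.2 hw, ?_⟩
    rw [e2]
    simp only [mul_assoc]

end Squarefree

end MerelHecke

end

open MerelHecke
theorem mainTheorem6 (N : ℕ) [NeZero N] (G : Subgroup (GL (Fin 2) (ZMod N)))
    (k : ℕ) (_hk : 2 ≤ k) (n : ℤ) [NeZero n]
    (δ : GL (Fin 2) (ZMod N)) (_hδG : δ ∈ G)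
    (hδ : (δ : Matrix (Fin 2) (Fin 2) (ZMod N)).det = (n : ZMod N))
    (s : G0Cosets G → SL(2, ℤ)) (_hs : ∀ q, projG0 G (s q) = q) :
    tildeSet (DeltaN G n) * SLset = Set.range (toGLQ : M2Z n → GL (Fin 2) ℚ) ∧
    (Squarefree n → ∀ α ∈ DeltaN G n,
      (groupQ (GammaG G) : Set (GL (Fin 2) ℚ)) * {α} * (groupQ (GammaG G) : Set _) =
        DeltaN G n) ∧
    ∃ h : IsMerelPair (GammaG G) (DeltaN G n) (phiQ G δ hδ s),
      ∀ u : M2Z n →₀ ℂ, ConditionC n u → ∀ (P : HomPoly (k - 2)) (g : SL(2, ℤ)),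
        heckeDual k h.isHeckeSet (manin k (GammaG G) P g) =
          u.sum fun M c =>
            c • manin k (GammaG G) (polyRep (k - 2) (tilde (toGLQ M)) P)
              (phiN G δ hδ s (leftMul g M)) :=
  ⟨tildeSet_DeltaN_mul_SLset _hδG hδ _hs,
    fun hsq _ hα => DeltaN_eq_doubleCoset (isUnit_of_det_eq hδ) hsq hα,
    isMerelPair_DeltaN _hδG hδ _hs,
    fun u hu P g => heckeDual_manin_eq_sum k _hδG hδ _hs _ u hu P g⟩
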